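/- Let $d\ge 1$ be an integer, let $\varepsilon\in(0,1)$, let $G$ be a finite additive abelian group and let $A\subseteq G$ with $\delta=|A|/|G|$. Sets are identified with their indicator functions, and $\mathbb E_{x\in X}$ denotes the average over a finite set $X$. For $f:G\to\mathbb R$ let $$\|f\|_{U^{d+1}}=\Big(\mathbb E_{x,h_1,\dots,h_{d+1}\in G}\prod_{\omega\in\{0,1\}^{d+1}}f\Big(x+\sum_{i=1}^{d+1}\omega_ih_i\Big)\Big)^{1/2^{d+1}}.$$ For $k\ge d+1$ let $\Gamma^{(k)}_A$ be the $k$-uniform hypergraph (with loops) on the vertex set $G$ in which $(x_1,\dots,x_k)\in G^k$ is an edge if and only if $x_1+\dots+x_k\in A$. For a $k$-uniform hypergraph $H$ with loops, i.e. a symmetric set $E(H)\subseteq V^k$ over a finite vertex set $V$, with density $\delta(H)=|E(H)|/|V|^k$ and edge indicator function $H:V^k\to\{0,1\}$, let $$\mathrm{disc}_d(H)=\max_{S_B\subseteq V^B\ \forall B\in\binom{[k]}{d}}\bigg|\mathbb E_{\mathbf x\in V^k}\Big[(H(\mathbf x)-\delta(H))\prod_{B\in\binom{[k]}{d}}S_B\big((x_j)_{j\in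 B}\big)\Big]\bigg|,$$ where the maximum is over all families of sets $S_B\subseteq V^B$ indexed by the $d$-element subsets $B$ of $[k]=\{1,\dots,k\}$. (i) If $\|A-\delta\|_{U^{d+1}}\le\varepsilon$, then $\mathrm{disc}_d(\Gamma^{(k)}_A)\le\varepsilon$ for every integer $k\ge d+1$. (ii) Conversely, if $\mathrm{disc}_d(\Gamma^{(k)}_A)\le\varepsilon$ for some integer $k\ge d+1$, then $\|A-\delta\|_{U^{d+1}}\le 2\varepsilon^{c_{k,d}}$, where $c_{k,d}=2^{-(d+2)(2d+2)^k}$. -/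

import Mathlib

open scoped BigOperators

noncomputable section

/-- The real-valued indicator function of a set. -/
def setInd {α : Type*} (S : Set α) (x : α) : ℝ :=
  S.indicator (fun _ => (1 : ℝ)) x

/-- The density `|A| / |G|` of a subset of a finite type. -/
def setDensity {G : Type*} [Fintype G] (A : Set G) : ℝ :=
  (A.ncard : ℝ) / (Fintype.card G : ℝ)

/-- The Gowers uniformity norm
`‖f‖_{U^k} = (𝔼_{x, h₁, …, h_k ∈ G} ∏_{ω ∈ {0,1}^k} f (x + ∑ i, ω_i h_i)) ^ (1 / 2^k)`. -/
def uniformityNorm {G : Type*} [AddCommGroup G] [Fintype G] (k : ℕ) (f : G → ℝ) : ℝ :=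
  (𝔼 x : G, 𝔼 h : Fin k → G,
      ∏ ω : Fin k → Fin 2, f (x + ∑ i, (ω i : ℕ) • h i)) ^ ((1 : ℝ) / 2 ^ k)

/-- `A` is `ε`-uniform of degree `d` if `‖A - δ‖_{U^{d+1}} ≤ ε`, with `δ = |A| / |G|`. -/
def IsUniformOfDegree {G : Type*} [AddCommGroup G] [Fintype G]
    (ε : ℝ) (d : ℕ) (A : Set G) : Prop :=
  uniformityNorm (d + 1) (fun x => setInd A x - setDensity A) ≤ ε

/-- A `k`-uniform hypergraph with loops on the vertex set `V`: a symmetric subset of `V^k`. -/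
structure KGraph (k : ℕ) (V : Type*) where
  edges : Set (Fin k → V)
  symm : ∀ (σ : Equiv.Perm (Fin k)) (x : Fin k → V), x ∈ edges → x ∘ σ ∈ edges

/-- The edge density `e(H) / v(H)^k`. -/
def KGraph.density {k : ℕ} {V : Type*} [Fintype V] (H : KGraph k V) : ℝ :=
  (H.edges.ncard : ℝ) / (Fintype.card V : ℝ) ^ k

/-- The `d`-cut norm of `f : V^k → ℝ`: the maximum, over all families of sets `S_B ⊆ V^B`
indexed by the `d`-element subsets `B` of the `k` coordinates, of
`|𝔼_{x ∈ V^k} f(x) ∏_B S_B(x_B)|`. There are finitely many such families, so that the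
supremum is attained. -/
def cutNorm {k : ℕ} {V : Type*} [Fintype V] (d : ℕ) (f : (Fin k → V) → ℝ) : ℝ :=
  ⨆ S : (B : {B : Finset (Fin k) // B.card = d}) → Set (B.1 → V),
    |𝔼 x : Fin k → V, f x * ∏ B, setInd (S B) (fun j => x j.1)|

/-- The `d`-discrepancy `disc_d(H) = ‖H - δ(H)‖` in the `d`-cut norm. -/
def KGraph.disc {k : ℕ} {V : Type*} [Fintype V] (d : ℕ) (H : KGraph k V) : ℝ :=
  cutNorm d (fun x => setInd H.edges x - H.density)

/-- `H` is `ε`-quasirandom of order `d` if `disc_d(H) ≤ ε`. -/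
def KGraph.IsQuasirandomOfOrder {k : ℕ} {V : Type*} [Fintype V]
    (ε : ℝ) (d : ℕ) (H : KGraph k V) : Prop :=
  H.disc d ≤ ε

/-- The Cayley `k`-graph of `A`: `x₁, …, x_k` form an edge iff `x₁ + ⋯ + x_k ∈ A`. -/
def cayleyKGraph {G : Type*} [AddCommGroup G] (k : ℕ) (A : Set G) : KGraph k G where
  edges := {x | ∑ i, x i ∈ A}
  symm σ x hx := by
    have h : ∑ i, (x ∘ σ) i = ∑ i, x i := Equiv.sum_comp σ x
    change ∑ i, (x ∘ σ) i ∈ A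
    rw [h]
    exact hx

end

/-! Put f = A - δ. For (i), fix a set K of d + 1 coordinates. Each d-set misses a coordinate of K,
so the test product regroups into factors indexed by j ∈ K, the j-th independent of x_j.
Cauchy–Schwarz in each coordinate of K removes these factors and leaves the Gowers average of f,
because the sum of the coordinates is uniform on G (`cutNorm_comp_sum_le_uniformityNorm`).

For (ii), expanding the Gowers average and fixing one copy of the variables shows that f(x_1 + ⋯ +
x_{d+1}) correlates with a product of functions of d coordinates. This passes to one more coordinate
u (`SumCorrelates.insert_coord`) through the substitution x_v ↦ x_v + x_u. Factors containing v
would then see d + 1 coordinates, so they are first replaced one at a time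
(`PartialCorrelates.step`). A factor on B is exchanged, by Cauchy–Schwarz, for the dual function D,
the average over the coordinates outside B of everything else. Further Cauchy–Schwarz steps
eliminate f and bound the correlation by an average of D over pairs of parallel cubes. A change of
variables makes one vertex D(…, x_v + x_u, …) while every other vertex depends on at most d
coordinates. Unfolding D recovers f and the other factors, with a_B replaced by a product that
remains admissible after the substitution.

At k coordinates, bounded functions are rounded to sets at the cost of a factor 2 each
(`exists_set_abs_expect_mul_le`). -/

/-! ### Conditional averages and the Gowers–Cauchy–Schwarz inequality. -/

section Averages

variable {ι V : Type*} [Fintype ι] [DecidableEq ι] [Fintype V]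

/-- Exchanging the coordinates outside `B` between two vectors. -/
def piecewiseSwap (B : Finset ι) : ((ι → V) × (ι → V)) ≃ ((ι → V) × (ι → V)) where
  toFun p := (B.piecewise p.1 p.2, B.piecewise p.2 p.1)
  invFun p := (B.piecewise p.1 p.2, B.piecewise p.2 p.1)
  left_inv p := by
    ext i <;> by_cases h : i ∈ B <;> simp [h]
  right_inv p := by
    ext i <;> by_cases h : i ∈ B <;> simp [h]

theorem expect_prod_type {α β : Type*} [Fintype α] [Fintype β] (f : α × β → ℝ) :
    𝔼 p, f p = 𝔼 a, 𝔼 b, f (a, b) :=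
  Finset.expect_product (M := ℝ) Finset.univ Finset.univ f

theorem expect_piecewise [Nonempty V] (B : Finset ι) (φ : (ι → V) → ℝ) :
    𝔼 x, 𝔼 y, φ (B.piecewise x y) = 𝔼 x, φ x := by
  have h := Fintype.expect_equiv (piecewiseSwap (V := V) B)
    (fun p => φ (B.piecewise p.1 p.2)) (fun p => φ p.1) (fun p => rfl)
  rw [expect_prod_type, expect_prod_type] at h
  simpa using h

theorem expect_mul_of_dependsOn [Nonempty V] {B : Finset ι} {H : (ι → V) → ℝ}
    (hH : DependsOn H (B : Set ι)) (φ : (ι → V) → ℝ) :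
    𝔼 x, φ x * H x = 𝔼 x, (𝔼 y, φ (B.piecewise x y)) * H x := by
  rw [← expect_piecewise B]
  refine Finset.expect_congr rfl fun x _ => ?_
  rw [Finset.expect_mul]
  refine Finset.expect_congr rfl fun y _ => ?_
  congr 1
  exact hH fun i hi => by simp [Finset.mem_coe.1 hi]

theorem dependsOn_expect_piecewise (B : Finset ι) (φ : (ι → V) → ℝ) :
    DependsOn (fun x => 𝔼 y, φ (B.piecewise x y)) (B : Set ι) := by
  intro x y h
  refine Finset.expect_congr rfl fun z _ => ?_
  congr 1
  ext i
  by_cases hi : i ∈ B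
  · simp [hi, h i hi]
  · simp [hi]

theorem abs_expect_le_one {α : Type*} [Fintype α] [Nonempty α] {f : α → ℝ}
    (h : ∀ x, |f x| ≤ 1) : |𝔼 x, f x| ≤ 1 :=
  (Finset.abs_expect_le _ _).trans (Finset.expect_le Finset.univ_nonempty fun x _ => h x)

theorem sq_expect_le {α : Type*} [Fintype α] [Nonempty α] (f : α → ℝ) :
    (𝔼 x, f x) ^ 2 ≤ 𝔼 x, f x ^ 2 := by
  simpa using Finset.expect_mul_sq_le_sq_mul_sq Finset.univ f (fun _ => (1 : ℝ))

theorem sq_expect_mul_le {α : Type*} [Fintype α] [Nonempty α] (f g : α → ℝ)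
    (hg : ∀ x, |g x| ≤ 1) : (𝔼 x, f x * g x) ^ 2 ≤ 𝔼 x, f x ^ 2 := by
  refine (Finset.expect_mul_sq_le_sq_mul_sq Finset.univ f g).trans ?_
  refine mul_le_of_le_one_right (Finset.expect_nonneg fun _ _ => sq_nonneg _) ?_
  refine Finset.expect_le Finset.univ_nonempty fun x _ => ?_
  rw [sq_le_one_iff_abs_le_one]
  exact hg x

theorem exists_le_of_le_expect_univ {α : Type*} [Fintype α] [Nonempty α] {f : α → ℝ} {a : ℝ}
    (h : a ≤ 𝔼 x, f x) : ∃ x, a ≤ f x := by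
  obtain ⟨x, -, hx⟩ := Finset.exists_le_of_le_expect Finset.univ_nonempty h
  exact ⟨x, hx⟩

/-- Averaging out the coordinates outside B is an orthogonal projection fixing H. Cauchy–Schwarz
bounds the left side by the squared norm of the projection of φ, which is its inner product with φ.
-/
theorem sq_expect_mul_le_of_dependsOn [Nonempty V] {B : Finset ι} {H : (ι → V) → ℝ}
    (hH : DependsOn H (B : Set ι)) (hH1 : ∀ x, |H x| ≤ 1) (φ : (ι → V) → ℝ) :
    (𝔼 x, φ x * H x) ^ 2 ≤ 𝔼 x, φ x * 𝔼 y, φ (B.piecewise x y) := by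
  rw [expect_mul_of_dependsOn hH, expect_mul_of_dependsOn (dependsOn_expect_piecewise B φ)]
  refine (sq_expect_mul_le _ _ hH1).trans_eq ?_
  simp only [sq]

/-- The Gowers–Cauchy–Schwarz inequality: factors that miss one of the coordinates in `S`
can be removed at the cost of doubling each of these coordinates. -/
theorem abs_expect_mul_prod_pow_le [Nonempty V] (S : Finset ι) :
    ∀ (F : (ι → V) → ℝ) (h : ι → (ι → V) → ℝ), (∀ j x, |h j x| ≤ 1) →
      (∀ j, DependsOn (h j) (({j}ᶜ : Finset ι) : Set ι)) →
      |𝔼 x, F x * ∏ j ∈ S, h j x| ^ 2 ^ S.card ≤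
        |𝔼 x, 𝔼 y, ∏ T ∈ S.powerset, F (T.piecewise y x)| ∧
      (S.Nonempty → 0 ≤ 𝔼 x, 𝔼 y, ∏ T ∈ S.powerset, F (T.piecewise y x)) := by
  induction S using Finset.induction_on with
  | empty => intro F h _ _; simp
  | insert j S hj ih =>
    intro F h h1 hd
    suffices hs : |𝔼 x, F x * ∏ j ∈ insert j S, h j x| ^ 2 ^ (insert j S).card ≤
        𝔼 x, 𝔼 y, ∏ T ∈ (insert j S).powerset, F (T.piecewise y x) from
      ⟨hs.trans (le_abs_self _), fun _ => le_trans (by positivity) hs⟩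
    -- The factor `h j` is absorbed into F and removed by the final Cauchy–Schwarz, in the variable
    -- x_j.
    have key := And.left <| ih (fun x => F x * h j x) h h1 hd
    have e1 : ∀ x, F x * ∏ i ∈ insert j S, h i x = F x * h j x * ∏ i ∈ S, h i x := fun x => by
      rw [Finset.prod_insert hj]; ring
    simp only [e1]
    rw [Finset.card_insert_of_notMem hj, pow_succ, pow_mul]
    refine (pow_le_pow_left₀ (by positivity) key 2).trans ?_
    rw [sq_abs, Finset.expect_comm]
    refine (sq_expect_le _).trans ?_
    have e2 : ∀ x y : ι → V, ∏ T ∈ (insert j S).powerset, F (T.piecewise y x) =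
        (∏ T ∈ S.powerset, F (T.piecewise y x)) *
          ∏ T ∈ S.powerset, F (T.piecewise y (Function.update x j (y j))) := by
      intro x y
      rw [Finset.prod_powerset_insert hj]
      congr 1
      refine Finset.prod_congr rfl fun T hT => ?_
      congr 1
      have hjT : j ∉ T := fun h' => hj (Finset.mem_powerset.1 hT h')
      ext i
      by_cases hi : i = j
      · subst hi; simp [hjT]
      · by_cases hiT : i ∈ T <;> simp [hi, hiT]
    have e3 : ∀ y : ι → V, (𝔼 x, ∏ T ∈ S.powerset,
          F (T.piecewise y x) * h j (T.piecewise y x)) ^ 2 ≤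
        𝔼 x, 𝔼 z : ι → V, (∏ T ∈ S.powerset, F (T.piecewise y x)) *
          ∏ T ∈ S.powerset, F (T.piecewise y (Function.update x j (z j))) := by
      intro y
      simp only [Finset.prod_mul_distrib]
      refine (sq_expect_mul_le_of_dependsOn (B := {j}ᶜ) ?_ ?_ _).trans_eq ?_
      · intro x x' hxz
        refine Finset.prod_congr rfl fun T _ => hd j fun i hi => ?_
        by_cases hiT : i ∈ T
        · simp [hiT]
        · simp [hiT, hxz i hi]
      · intro x
        rw [Finset.abs_prod]
        exact Finset.prod_le_one (fun _ _ => abs_nonneg _) fun _ _ => h1 _ _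
      · refine Finset.expect_congr rfl fun x _ => ?_
        rw [Finset.mul_expect]
        refine Finset.expect_congr rfl fun z _ => ?_
        congr 1
        refine Finset.prod_congr rfl fun T _ => ?_
        congr 2
        ext i
        by_cases hi : i = j
        · subst hi; simp
        · simp [hi]
    refine (Finset.expect_le_expect fun y _ => e3 y).trans_eq ?_
    rw [Finset.expect_comm]
    refine Finset.expect_congr rfl fun x _ => ?_
    simp only [e2]
    conv_rhs => rw [← expect_piecewise {j}ᶜ]
    refine Finset.expect_congr rfl fun y _ => Finset.expect_congr rfl fun z _ => ?_
    -- No T ⊆ S contains j, so these vertices never see y_j, which is free to serve as the second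
    -- copy of x_j.
    have e4 : ∀ (x : ι → V), ∀ T ∈ S.powerset,
        T.piecewise (({j}ᶜ : Finset ι).piecewise y z) x = T.piecewise y x := by
      intro x T hT
      have hjT : j ∉ T := fun h' => hj (Finset.mem_powerset.1 hT h')
      ext i
      by_cases hiT : i ∈ T
      · have : i ≠ j := fun h' => hjT (h' ▸ hiT)
        simp [hiT, this]
      · simp [hiT]
    congr 1
    · exact Finset.prod_congr rfl fun T hT => by rw [e4 _ T hT]
    · refine Finset.prod_congr rfl fun T hT => ?_
      rw [e4 _ T hT]
      simp

end Averages

/-! ### Products of bounded functions of few coordinates. -/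

section ProductClass

variable {ι V : Type*}

/-- Products of functions with values in `[-1, 1]`, each of which depends only on the
coordinates in some member of the family `𝓕`. -/
def productClass (V : Type*) {ι : Type*} (𝓕 : Set (Finset ι)) : Submonoid ((ι → V) → ℝ) :=
  Submonoid.closure {g | (∀ x, |g x| ≤ 1) ∧ ∃ B ∈ 𝓕, DependsOn g (B : Set ι)}

theorem mem_productClass_of_dependsOn {𝓕 : Set (Finset ι)} {g : (ι → V) → ℝ}
    (hg : ∀ x, |g x| ≤ 1) {B : Finset ι} (hB : B ∈ 𝓕) (hd : DependsOn g (B : Set ι)) :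
    g ∈ productClass V 𝓕 :=
  Submonoid.subset_closure ⟨hg, B, hB, hd⟩

theorem abs_le_one_of_mem_productClass {𝓕 : Set (Finset ι)} {g : (ι → V) → ℝ}
    (hg : g ∈ productClass V 𝓕) (x : ι → V) : |g x| ≤ 1 := by
  induction hg using Submonoid.closure_induction with
  | mem g hg => exact hg.1 x
  | one => simp
  | mul f g _ _ hf hg =>
    rw [Pi.mul_apply, abs_mul]
    exact mul_le_one₀ hf (abs_nonneg _) hg

theorem comp_mem_productClass {𝓕 𝓖 : Set (Finset ι)} {g : (ι → V) → ℝ}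
    (hg : g ∈ productClass V 𝓕) (σ : (ι → V) → ι → V)
    (hσ : ∀ B ∈ 𝓕, ∃ C ∈ 𝓖, ∀ x y : ι → V, (∀ i ∈ C, x i = y i) → ∀ i ∈ B, σ x i = σ y i) :
    g ∘ σ ∈ productClass V 𝓖 := by
  induction hg using Submonoid.closure_induction with
  | mem g hg =>
    obtain ⟨h1, B, hB, hd⟩ := hg
    obtain ⟨C, hC, h⟩ := hσ B hB
    exact mem_productClass_of_dependsOn (fun x => h1 _) hC
      fun x y hxy => hd fun i hi => h x y hxy i hi
  | one => exact one_mem _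
  | mul f g _ _ hf hg => exact mul_mem hf hg

/-- Each factor is assigned to one `c j` containing its coordinates, which gives a single factor per
index. Taking `c j = {j}ᶜ` prepares Gowers–Cauchy–Schwarz; taking the d-sets themselves prepares the
cut norm. -/
theorem exists_eq_prod_of_mem_productClass {κ : Type*} [DecidableEq κ] {𝓕 : Set (Finset ι)}
    {g : (ι → V) → ℝ} (hg : g ∈ productClass V 𝓕) (S : Finset κ) (c : κ → Finset ι)
    (hc : ∀ B ∈ 𝓕, ∃ j ∈ S, B ⊆ c j) :
    ∃ h : κ → (ι → V) → ℝ, (∀ j x, |h j x| ≤ 1) ∧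
      (∀ j, DependsOn (h j) (c j : Set ι)) ∧ ∀ x, g x = ∏ j ∈ S, h j x := by
  induction hg using Submonoid.closure_induction with
  | mem g hg =>
    obtain ⟨h1, B, hB, hd⟩ := hg
    obtain ⟨j, hj, hBj⟩ := hc B hB
    refine ⟨fun i => if i = j then g else 1, fun i x => ?_, fun i => ?_, fun x => ?_⟩
    · dsimp only; split_ifs <;> simp [h1]
    · dsimp only
      split_ifs with h
      · subst h; exact hd.mono (by exact_mod_cast hBj)
      · intro x y _; rfl
    · rw [Finset.prod_eq_single_of_mem j hj]
      · simp
      · intro i _ hi; simp [hi]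
  | one => exact ⟨fun _ => 1, by simp, fun _ _ _ _ => rfl, by simp⟩
  | mul f g _ _ hf hg =>
    obtain ⟨a, a1, a2, a3⟩ := hf
    obtain ⟨b, b1, b2, b3⟩ := hg
    refine ⟨fun j => a j * b j, fun j x => ?_, fun j x y hxy => ?_, fun x => ?_⟩
    · change |a j x * b j x| ≤ 1
      rw [abs_mul]; exact mul_le_one₀ (a1 j x) (abs_nonneg _) (b1 j x)
    · change a j x * b j x = a j y * b j y
      rw [a2 j hxy, b2 j hxy]
    · simp [a3, b3, Finset.prod_mul_distrib]

end ProductClass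

theorem abs_expect_mul_pow_le {ι V : Type*} [Fintype ι] [DecidableEq ι] [Fintype V]
    [Nonempty V] {S : Finset ι} (hS : S.Nonempty) (F : (ι → V) → ℝ)
    {𝓕 : Set (Finset ι)}
    (h𝓕 : ∀ B ∈ 𝓕, ∃ j ∈ S, j ∉ B) {g : (ι → V) → ℝ} (hg : g ∈ productClass V 𝓕) :
    |𝔼 x, F x * g x| ^ 2 ^ S.card ≤ 𝔼 x, 𝔼 y, ∏ T ∈ S.powerset, F (T.piecewise y x) := by
  obtain ⟨h, h1, h2, h3⟩ := exists_eq_prod_of_mem_productClass hg S (fun j => {j}ᶜ)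
    (fun B hB => by
      obtain ⟨j, hj, hjB⟩ := h𝓕 B hB
      exact ⟨j, hj, fun i hi => by
        simpa using fun h' : i = j => hjB (h' ▸ hi)⟩)
  simp only [h3]
  have := abs_expect_mul_prod_pow_le S F h h1 h2
  rw [abs_of_nonneg (this.2 hS)] at this
  exact this.1

/-! ### Gowers averages as averages over coordinate cubes. -/

section GowersAverage

/-- Both sides equal the double average of φ(π x + y), by translation invariance in x and in y. -/
theorem expect_comp_addMonoidHom {H H' : Type*} [AddCommGroup H] [Fintype H] [AddCommGroup H']
    [Fintype H'] (π : H →+ H') (hπ : Function.Surjective π) (φ : H' → ℝ) :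
    𝔼 x, φ (π x) = 𝔼 y, φ y := by
  have h1 : ∀ y, 𝔼 x, φ (π x + y) = 𝔼 x, φ (π x) := by
    intro y
    obtain ⟨z, rfl⟩ := hπ y
    exact Fintype.expect_equiv (Equiv.addRight z) _ _ fun x => by simp
  have h2 : ∀ x, 𝔼 y, φ (π x + y) = 𝔼 y, φ y := fun x =>
    Fintype.expect_equiv (Equiv.addLeft (π x)) _ _ fun y => by simp
  calc 𝔼 x, φ (π x) = 𝔼 y : H', 𝔼 x, φ (π x + y) := by simp only [h1, Fintype.expect_const]
    _ = 𝔼 x : H, 𝔼 y, φ (π x + y) := Finset.expect_comm _ _ _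
    _ = 𝔼 y, φ y := by simp only [h2, Fintype.expect_const]

theorem expect_add_right_eq {H : Type*} [AddCommGroup H] [Fintype H] (c : H) (φ : H → ℝ) :
    𝔼 x, φ (x + c) = 𝔼 x, φ x :=
  Fintype.expect_equiv (Equiv.addRight c) _ _ fun x => by simp

/-- The average whose `2 ^ n`-th root is the Gowers norm of degree `n`. -/
noncomputable def gowersAverage {G : Type*} [AddCommGroup G] [Fintype G] (n : ℕ) (f : G → ℝ) : ℝ :=
  𝔼 x : G, 𝔼 h : Fin n → G, ∏ ω : Fin n → Fin 2, f (x + ∑ i, (ω i : ℕ) • h i)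

variable {ι G : Type*} [Fintype ι] [DecidableEq ι] [AddCommGroup G] [Fintype G]

theorem expect_sum_eq {A : Finset ι} (hA : A.Nonempty) (φ : G → ℝ) (c : G) :
    𝔼 x : ι → G, φ (∑ i ∈ A, x i + c) = 𝔼 s, φ s := by
  obtain ⟨j, hj⟩ := hA
  rw [← expect_add_right_eq c φ]
  refine expect_comp_addMonoidHom (H := ι → G)
    ⟨⟨fun x => ∑ i ∈ A, x i, by simp⟩, fun x y => by simp [Finset.sum_add_distrib]⟩ ?_
      (fun s => φ (s + c))
  intro t
  exact ⟨Pi.single j t, by simp [hj, Pi.single_apply]⟩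

theorem sum_piecewise_add {ι G : Type*} [DecidableEq ι] [AddCommGroup G] {A T : Finset ι}
    (hT : T ⊆ A) (x h : ι → G) :
    ∑ i ∈ A, T.piecewise (x + h) x i = ∑ i ∈ A, x i + ∑ i ∈ T, h i := by
  have : ∀ i, T.piecewise (x + h) x i = x i + if i ∈ T then h i else 0 := by
    intro i
    by_cases hi : i ∈ T <;> simp [hi]
  simp only [this, Finset.sum_add_distrib]
  rw [← Finset.sum_filter, Finset.filter_mem_eq_inter, Finset.inter_eq_right.2 hT]

theorem prod_powerset_eq_prod_cube {ι G : Type*} [DecidableEq ι] [AddCommGroup G] {n : ℕ}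
    {K : Finset ι} (e : Fin n ≃ K) (f : G → ℝ) (s : G) (h : ι → G) :
    ∏ T ∈ K.powerset, f (s + ∑ i ∈ T, h i) =
      ∏ ω : Fin n → Fin 2, f (s + ∑ i, (ω i : ℕ) • h (e i)) := by
  symm
  let e' : Fin n ↪ ι := e.toEmbedding.trans (Function.Embedding.subtype _)
  refine Finset.prod_nbij' (fun ω => (Finset.univ.filter fun i => ω i = 1).map e')
    (fun T i => if (e i : ι) ∈ T then 1 else 0) ?_ ?_ ?_ ?_ ?_
  · intro ω _
    rw [Finset.mem_powerset]
    intro j hj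
    obtain ⟨i, -, rfl⟩ := Finset.mem_map.1 hj
    exact (e i).2
  · simp
  · intro ω _
    ext i
    have : ((e i : ι) ∈ (Finset.univ.filter fun i => ω i = 1).map e') ↔ ω i = 1 := by
      constructor
      · intro h
        obtain ⟨j, hj, hji⟩ := Finset.mem_map.1 h
        have : j = i := e'.injective hji
        subst this
        simpa using hj
      · intro h
        exact Finset.mem_map.2 ⟨i, by simpa using h, rfl⟩
    simp only [this]
    generalize ω i = t
    fin_cases t <;> simp
  · intro T hT
    rw [Finset.mem_powerset] at hT
    ext j
    constructor
    · intro h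
      obtain ⟨i, hi, rfl⟩ := Finset.mem_map.1 h
      by_contra h'
      have h'' : (e i : ι) ∉ T := h'
      simp [h''] at hi
    · intro h
      refine Finset.mem_map.2 ⟨e.symm ⟨j, hT h⟩, ?_, ?_⟩
      · simp [h]
      · simp [e']
  · intro ω _
    congr 2
    rw [Finset.sum_map, Finset.sum_filter]
    refine Finset.sum_congr rfl fun i _ => ?_
    change _ = if ω i = 1 then h (e i) else 0
    generalize ω i = t
    fin_cases t <;> simp

/-- With h = y - x, the vertex T has coordinate sum s + ∑_{i ∈ T} h_i, where s = ∑_{i ∈ A} x_i is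
uniform and independent of h. -/
theorem expect_prod_powerset_eq_gowersAverage {A K : Finset ι} (hKA : K ⊆ A) (hA : A.Nonempty)
    {n : ℕ} (hn : K.card = n) (f : G → ℝ) :
    𝔼 x : ι → G, 𝔼 y, ∏ T ∈ K.powerset, f (∑ i ∈ A, T.piecewise y x i) = gowersAverage n f := by
  let e : Fin n ≃ K := (finCongr hn.symm).trans K.equivFin.symm
  have h1 : ∀ x : ι → G, 𝔼 y, ∏ T ∈ K.powerset, f (∑ i ∈ A, T.piecewise y x i) =
      𝔼 h : ι → G, ∏ T ∈ K.powerset, f (∑ i ∈ A, x i + ∑ i ∈ T, h i) := by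
    intro x
    rw [← expect_add_right_eq x]
    refine Finset.expect_congr rfl fun h _ => Finset.prod_congr rfl fun T hT => ?_
    rw [add_comm h x, sum_piecewise_add ((Finset.mem_powerset.1 hT).trans hKA)]
  simp only [h1]
  have h2 := expect_sum_eq hA
    (fun s : G => 𝔼 h : ι → G, ∏ T ∈ K.powerset, f (s + ∑ i ∈ T, h i)) 0
  simp only [add_zero] at h2
  rw [h2]
  unfold gowersAverage
  refine Finset.expect_congr rfl fun s _ => ?_
  simp only [prod_powerset_eq_prod_cube e]
  refine expect_comp_addMonoidHom (H := ι → G) (H' := Fin n → G)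
    ⟨⟨fun x i => x (e i), rfl⟩, fun x y => rfl⟩ ?_
      (fun h => ∏ ω : Fin n → Fin 2, f (s + ∑ i, (ω i : ℕ) • h i))
  intro t
  refine ⟨fun j => if hj : j ∈ K then t (e.symm ⟨j, hj⟩) else 0, ?_⟩
  ext i
  simp

/-- A coordinate in A outside B makes the sum uniform even when the coordinates in B are fixed. -/
theorem expect_mul_comp_sum {A B : Finset ι} (hAB : (A \ B).Nonempty) {p : (ι → G) → ℝ}
    (hp : DependsOn p (B : Set ι)) (φ : G → ℝ) :
    𝔼 x : ι → G, φ (∑ i ∈ A, x i) * p x = (𝔼 s, φ s) * 𝔼 x, p x := by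
  rw [expect_mul_of_dependsOn hp, Finset.mul_expect]
  refine Finset.expect_congr rfl fun x _ => ?_
  congr 1
  rw [← expect_sum_eq hAB φ (∑ i ∈ A ∩ B, x i)]
  refine Finset.expect_congr rfl fun y _ => ?_
  congr 1
  rw [Finset.sum_piecewise, add_comm]

end GowersAverage

/-! ### The substitution that splits a coordinate into a sum of two. -/

section Shear

variable {ι G : Type*} [DecidableEq ι] [AddCommGroup G]

/-- Adding the coordinate `u` to the coordinate `v`. -/
def shear (u v : ι) (w : ι → G) : ι → G := Function.update w v (w v + w u)

/-- Subtracting the coordinate `u` from the coordinate `v`. -/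
def unshear (u v : ι) (w : ι → G) : ι → G := Function.update w v (w v - w u)

theorem shear_self (u v : ι) (w : ι → G) : shear u v w v = w v + w u := by simp [shear]

theorem shear_of_ne {u v i : ι} (h : i ≠ v) (w : ι → G) : shear u v w i = w i := by
  simp [shear, h]

theorem unshear_self (u v : ι) (w : ι → G) : unshear u v w v = w v - w u := by simp [unshear]

theorem unshear_of_ne {u v i : ι} (h : i ≠ v) (w : ι → G) : unshear u v w i = w i := by
  simp [unshear, h]

theorem unshear_shear {u v : ι} (huv : u ≠ v) (w : ι → G) : unshear u v (shear u v w) = w := by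
  ext i
  by_cases hi : i = v
  · subst hi; simp [unshear_self, shear_self, shear_of_ne huv]
  · simp [unshear_of_ne hi, shear_of_ne hi]

theorem shear_unshear {u v : ι} (huv : u ≠ v) (w : ι → G) : shear u v (unshear u v w) = w := by
  ext i
  by_cases hi : i = v
  · subst hi; simp [unshear_self, shear_self, unshear_of_ne huv]
  · simp [unshear_of_ne hi, shear_of_ne hi]

/-- The shear as a permutation. -/
def shearEquiv {u v : ι} (huv : u ≠ v) : (ι → G) ≃ (ι → G) :=
  ⟨shear u v, unshear u v, unshear_shear huv, shear_unshear huv⟩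

theorem expect_shear [Fintype ι] [Fintype G] {u v : ι} (huv : u ≠ v) (φ : (ι → G) → ℝ) :
    𝔼 w, φ (shear u v w) = 𝔼 w, φ w :=
  Fintype.expect_equiv (shearEquiv huv) _ _ fun _ => rfl

theorem sum_shear {u v : ι} {A : Finset ι} (hu : u ∉ A) (hv : v ∈ A) (w : ι → G) :
    ∑ i ∈ A, shear u v w i = ∑ i ∈ insert u A, w i := by
  rw [Finset.sum_insert hu, ← Finset.add_sum_erase _ _ hv, ← Finset.add_sum_erase _ _ hv,
    shear_self, Finset.sum_congr rfl fun i hi => shear_of_ne (Finset.ne_of_mem_erase hi) w]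
  abel

end Shear

/-! ### Dual functions and pairs of parallel cubes. -/

section ParallelCubes

variable {ι G : Type*} [Fintype ι] [DecidableEq ι] [AddCommGroup G] [Fintype G]

theorem productClass_mono {ι V : Type*} {𝓕 𝓖 : Set (Finset ι)} (h : 𝓕 ⊆ 𝓖) :
    productClass V 𝓕 ≤ productClass V 𝓖 :=
  Submonoid.closure_mono fun _ hg => ⟨hg.1, hg.2.imp fun _ hB => ⟨h hB.1, hB.2⟩⟩

/-- Gowers–Cauchy–Schwarz over B removes g. A coordinate in A \ B decouples f from D once h is
fixed, and one more Cauchy–Schwarz in h discards f and squares the cube average of D. -/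
theorem pow_abs_expect_le_parallel {A B : Finset ι} (hBA : B ⊆ A) (hB : B.Nonempty)
    (hAB : (A \ B).Nonempty) {f : G → ℝ} (hf : ∀ s, |f s| ≤ 1) {D : (ι → G) → ℝ}
    (hD : DependsOn D (B : Set ι)) {𝓕 : Set (Finset ι)} (h𝓕 : ∀ C ∈ 𝓕, ∃ j ∈ B, j ∉ C)
    {g : (ι → G) → ℝ} (hg : g ∈ productClass G 𝓕) :
    |𝔼 x, f (∑ i ∈ A, x i) * D x * g x| ^ 2 ^ (B.card + 1) ≤
      𝔼 h : ι → G, (𝔼 x, ∏ T ∈ B.powerset, D (T.piecewise (x + h) x)) ^ 2 := by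
  have h1 := abs_expect_mul_pow_le hB (fun x => f (∑ i ∈ A, x i) * D x) h𝓕 hg
  have h2 : 𝔼 x : ι → G, 𝔼 y, ∏ T ∈ B.powerset,
        (f (∑ i ∈ A, T.piecewise y x i) * D (T.piecewise y x)) =
      𝔼 h : ι → G, (𝔼 x, ∏ T ∈ B.powerset, D (T.piecewise (x + h) x)) *
        𝔼 s, ∏ T ∈ B.powerset, f (s + ∑ i ∈ T, h i) := by
    have e1 : ∀ x : ι → G, 𝔼 y, ∏ T ∈ B.powerset,
        (f (∑ i ∈ A, T.piecewise y x i) * D (T.piecewise y x)) =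
        𝔼 h, (∏ T ∈ B.powerset, f (∑ i ∈ A, x i + ∑ i ∈ T, h i)) *
          ∏ T ∈ B.powerset, D (T.piecewise (x + h) x) := by
      intro x
      rw [← expect_add_right_eq x]
      refine Finset.expect_congr rfl fun h _ => ?_
      rw [← Finset.prod_mul_distrib]
      refine Finset.prod_congr rfl fun T hT => ?_
      rw [add_comm h x, sum_piecewise_add ((Finset.mem_powerset.1 hT).trans hBA)]
    simp only [e1]
    rw [Finset.expect_comm]
    refine Finset.expect_congr rfl fun h _ => ?_
    rw [expect_mul_comp_sum hAB (p := fun x => ∏ T ∈ B.powerset, D (T.piecewise (x + h) x)) ?_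
      (fun s => ∏ T ∈ B.powerset, f (s + ∑ i ∈ T, h i)), mul_comm]
    intro x y hxy
    refine Finset.prod_congr rfl fun T _ => hD fun i hi => ?_
    by_cases hiT : i ∈ T <;> simp [hiT, hxy i hi]
  rw [h2] at h1
  rw [pow_succ, pow_mul]
  refine (pow_le_pow_left₀ (by positivity) h1 2).trans (sq_expect_mul_le _ _ fun h => ?_)
  refine abs_expect_le_one fun s => ?_
  rw [Finset.abs_prod]
  exact Finset.prod_le_one (fun _ _ => abs_nonneg _) fun _ _ => hf _

theorem expect_change_of_variables {u v : ι} (huv : u ≠ v)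
    (Θ : (ι → G) → (ι → G) → (ι → G) → ℝ) :
    𝔼 h, 𝔼 x, 𝔼 y, Θ x y h = 𝔼 r : ι → G, 𝔼 p : ι → G, 𝔼 w : ι → G,
      Θ (shear u v w) (r + Pi.single v (w u)) (p - Function.update w v (w u)) := by
  calc _ = 𝔼 x, 𝔼 y, 𝔼 h, Θ x y h := by
        rw [Finset.expect_comm]
        exact Finset.expect_congr rfl fun x _ => Finset.expect_comm _ _ _
    _ = 𝔼 w, 𝔼 y, 𝔼 h, Θ (shear u v w) y h :=
        (expect_shear huv fun x => 𝔼 y, 𝔼 h, Θ x y h).symm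
    _ = 𝔼 w : ι → G, 𝔼 r : ι → G, 𝔼 p : ι → G, Θ (shear u v w) (r + Pi.single v (w u))
          (p - Function.update w v (w u)) := by
        refine Finset.expect_congr rfl fun w _ => ?_
        rw [← expect_add_right_eq (Pi.single v (w u))]
        refine Finset.expect_congr rfl fun r _ => ?_
        rw [← expect_add_right_eq (-Function.update w v (w u))]
        simp only [sub_eq_add_neg]
    _ = 𝔼 r : ι → G, 𝔼 p : ι → G, 𝔼 w : ι → G, Θ (shear u v w) (r + Pi.single v (w u))
          (p - Function.update w v (w u)) := by
        rw [Finset.expect_comm]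
        exact Finset.expect_congr rfl fun x _ => Finset.expect_comm _ _ _

/-- If the function `D` of the coordinates in `B ∋ v` has a large average over pairs of parallel
cubes, then `D`, with the coordinate `v` split as a sum of the coordinates `u` and `v`,
correlates with a product of functions of `#B` coordinates. -/
theorem exists_parallel_le_expect_shear {B : Finset ι} {u v : ι} (hv : v ∈ B) (hu : u ∉ B)
    {D : (ι → G) → ℝ} (hD : DependsOn D (B : Set ι)) (hD1 : ∀ x, |D x| ≤ 1) :
    ∃ q ∈ productClass G {C | C = B ∨ (u ∈ C ∧ C ⊆ insert u B ∧ C.card ≤ B.card)},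
      𝔼 h : ι → G, (𝔼 x, ∏ T ∈ B.powerset, D (T.piecewise (x + h) x)) ^ 2 ≤
        𝔼 w, D (shear u v w) * q w := by
  have huv : u ≠ v := fun h => hu (h ▸ hv)
  have h1 : 𝔼 h : ι → G, (𝔼 x, ∏ T ∈ B.powerset, D (T.piecewise (x + h) x)) ^ 2 =
      𝔼 r : ι → G, 𝔼 p : ι → G, 𝔼 w : ι → G,
        (∏ T ∈ B.powerset, D (T.piecewise
          (shear u v w + (p - Function.update w v (w u))) (shear u v w))) *
        ∏ T ∈ B.powerset, D (T.piecewise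
          (r + Pi.single v (w u) + (p - Function.update w v (w u))) (r + Pi.single v (w u))) := by
    rw [← expect_change_of_variables huv fun x y h =>
      (∏ T ∈ B.powerset, D (T.piecewise (x + h) x)) * ∏ T ∈ B.powerset, D (T.piecewise (y + h) y)]
    refine Finset.expect_congr rfl fun h _ => ?_
    rw [sq, Fintype.expect_mul_expect]
  obtain ⟨r, hr⟩ := exists_le_of_le_expect_univ h1.le
  obtain ⟨p, hp⟩ := exists_le_of_le_expect_univ hr
  -- With r and p fixed, the shift cancels w_i on moved coordinates i ≠ v of the first cube, and
  -- cancels w_u at v in both cubes. Hence its vertices T ≠ ∅ see only B when v ∈ T and u with B \ T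
  -- otherwise, while the second cube sees only u and B \ {v}.
  refine ⟨(∏ T ∈ B.powerset.erase ∅, fun w => D (T.piecewise
          (shear u v w + (p - Function.update w v (w u))) (shear u v w))) *
        ∏ T ∈ B.powerset, fun w => D (T.piecewise
          (r + Pi.single v (w u) + (p - Function.update w v (w u))) (r + Pi.single v (w u))),
      mul_mem (prod_mem fun T hT => ?_) (prod_mem fun T hT => ?_), hp.trans_eq ?_⟩
  · rw [Finset.mem_erase, Finset.mem_powerset] at hT
    by_cases hvT : v ∈ T
    · refine mem_productClass_of_dependsOn (fun _ => hD1 _) (B := B) (Or.inl rfl) ?_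
      intro x y hxy
      refine hD fun i hi => ?_
      by_cases hiv : i = v
      · subst hiv
        simp [hvT, shear_self, hxy i hi]
      · by_cases hiT : i ∈ T <;> simp [hiT, hiv, shear_of_ne hiv, hxy i hi]
    · refine mem_productClass_of_dependsOn (fun _ => hD1 _) (B := insert u (B \ T))
        (Or.inr ⟨by simp, Finset.insert_subset_insert _ Finset.sdiff_subset, ?_⟩) ?_
      · have h2 := Finset.card_sdiff_add_card_eq_card hT.2
        have h3 := (Finset.nonempty_iff_ne_empty.2 hT.1).card_pos
        have h4 := Finset.card_insert_le u (B \ T)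
        omega
      · intro x y hxy
        refine hD fun i hi => ?_
        by_cases hiT : i ∈ T
        · have hiv : i ≠ v := fun h => hvT (h ▸ hiT)
          simp [hiT, hiv, shear_of_ne hiv]
        · have hiB : x i = y i := hxy i (by simpa [hiT] using Or.inr hi)
          by_cases hiv : i = v
          · subst hiv
            simp [hiT, shear_self, hiB, hxy u (by simp)]
          · simp [hiT, shear_of_ne hiv, hiB]
  · refine mem_productClass_of_dependsOn (fun _ => hD1 _) (B := insert u (B.erase v))
      (Or.inr ⟨by simp, Finset.insert_subset_insert _ (Finset.erase_subset _ _), ?_⟩) ?_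
    · have h2 := Finset.card_erase_add_one hv
      have h4 := Finset.card_insert_le u (B.erase v)
      omega
    · intro x y hxy
      refine hD fun i hi => ?_
      have hxu : x u = y u := hxy u (by simp)
      by_cases hiv : i = v
      · subst hiv
        by_cases hiT : i ∈ T <;> simp [hiT, hxu]
      · have hiB : x i = y i := hxy i (by simpa [hiv] using Or.inr hi)
        by_cases hiT : i ∈ T <;> simp [hiT, hiv, hiB]
  · refine Finset.expect_congr rfl fun w _ => ?_
    rw [← Finset.mul_prod_erase _ _ (Finset.empty_mem_powerset B)]
    simp [Finset.prod_apply, mul_assoc]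

theorem expect_update_eq (u : ι) (ψ : (ι → G) → ℝ) :
    𝔼 y, 𝔼 c, ψ (Function.update y u c) = 𝔼 y, ψ y := by
  conv_rhs => rw [← expect_piecewise {u}ᶜ]
  refine Finset.expect_congr rfl fun y _ => ?_
  refine (expect_comp_addMonoidHom (H := ι → G) (Pi.evalAddMonoidHom (fun _ => G) u)
    (fun t => ⟨Pi.single u t, by simp⟩) fun c => ψ (Function.update y u c)).symm.trans ?_
  refine Finset.expect_congr rfl fun z _ => ?_
  congr 1
  ext i
  by_cases hi : i = u
  · subst hi; simp
  · simp [hi]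

/-- Since q ignores the coordinates outside B ∪ {u}, only the averaging over coordinate u survives,
as a random shift c. -/
theorem expect_dual_mul {B : Finset ι} {u : ι} (hu : u ∉ B) (R : (ι → G) → ℝ)
    {q : (ι → G) → ℝ} (hq : DependsOn q ((insert u B : Finset ι) : Set ι)) :
    𝔼 w, (𝔼 y, R (B.piecewise w y)) * q w = 𝔼 c : G, 𝔼 w, R (w + Pi.single u c) * q w := by
  rw [Finset.expect_comm]
  simp only [← Finset.expect_mul]
  have h := expect_mul_of_dependsOn hq fun w : ι → G => 𝔼 c : G, R (w + Pi.single u c)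
  refine Eq.trans ?_ h.symm
  refine Finset.expect_congr rfl fun w _ => ?_
  congr 1
  rw [← expect_update_eq u]
  refine Finset.expect_congr rfl fun y _ => ?_
  rw [← expect_add_right_eq (w u)]
  refine Finset.expect_congr rfl fun c _ => ?_
  congr 1
  ext i
  by_cases hi : i = u
  · subst hi; simp [hu, add_comm]
  · by_cases hiB : i ∈ B <;> simp [hi, hiB]

end ParallelCubes

/-! ### Passing the correlation from d + 1 to k coordinates. -/

section Correlation

variable {ι G : Type*} [Fintype ι] [DecidableEq ι] [AddCommGroup G] [Fintype G]

/-- `f (∑ i ∈ A, x i)` has correlation at least `η` with a product of bounded functions of at most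
`d` of the coordinates in `A`. -/
def SumCorrelates (f : G → ℝ) (A : Finset ι) (d : ℕ) (η : ℝ) : Prop :=
  ∃ g ∈ productClass G {B : Finset ι | B ⊆ A ∧ B.card ≤ d},
    η ≤ 𝔼 x : ι → G, f (∑ i ∈ A, x i) * g x

/-- The correlation of `f (∑ i ∈ A, x i)` with a product in which the factors indexed by `𝓣` have
not yet had their coordinate `v` split as a sum of the coordinates `u` and `v`. -/
def PartialCorrelates (f : G → ℝ) (A : Finset ι) (u v : ι) (d : ℕ) (𝓣 : Finset (Finset ι))
    (η : ℝ) : Prop :=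
  ∃ (a : Finset ι → (ι → G) → ℝ) (b : (ι → G) → ℝ), (∀ B x, |a B x| ≤ 1) ∧
    (∀ B, DependsOn (a B) (B : Set ι)) ∧
    b ∘ shear u v ∈ productClass G {C | C ⊆ insert u A ∧ C.card ≤ d ∧ C ∉ 𝓣} ∧
    η ≤ 𝔼 w : ι → G, f (∑ i ∈ A, w i) * ((∏ B ∈ 𝓣, a B w) * b w)

theorem abs_prod_le_one {κ : Type*} (s : Finset κ) {a : κ → ℝ} (h : ∀ i, |a i| ≤ 1) :
    |∏ i ∈ s, a i| ≤ 1 := by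
  rw [Finset.abs_prod]
  exact Finset.prod_le_one (fun _ _ => abs_nonneg _) fun _ _ => h _

theorem productClass_unshear {ι G : Type*} [DecidableEq ι] [AddCommGroup G] {u v : ι}
    (huv : u ≠ v) {𝓕 𝓖 : Set (Finset ι)} {b : (ι → G) → ℝ}
    (hb : b ∘ shear u v ∈ productClass G 𝓕)
    (h : ∀ C ∈ 𝓕, ∃ C' ∈ 𝓖, C ⊆ C' ∧ (v ∈ C → u ∈ C')) : b ∈ productClass G 𝓖 := by
  have : b = (b ∘ shear u v) ∘ unshear u v := by
    ext w
    simp [shear_unshear huv]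
  rw [this]
  refine comp_mem_productClass hb _ fun C hC => ?_
  obtain ⟨C', hC', hCC', hvu⟩ := h C hC
  refine ⟨C', hC', fun x y hxy i hi => ?_⟩
  by_cases hiv : i = v
  · subst hiv
    rw [unshear_self, unshear_self, hxy i (hCC' hi), hxy u (hvu hi)]
  · rw [unshear_of_ne hiv, unshear_of_ne hiv, hxy i (hCC' hi)]

/-- The exponent is one squaring to exchange a_B for its dual function D, then d + 1 squarings to
reach parallel cubes. -/
theorem PartialCorrelates.step {f : G → ℝ} (hf : ∀ s, |f s| ≤ 1) {A : Finset ι} {u v : ι} {d : ℕ}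
    {𝓣 : Finset (Finset ι)} {B : Finset ι} (hB𝓣 : B ∉ 𝓣)
    (h𝓣 : ∀ C ∈ insert B 𝓣, C ⊆ A ∧ C.card = d ∧ v ∈ C) (hu : u ∉ A) (hdA : d < A.card) {η : ℝ}
    (hη : 0 ≤ η) (h : PartialCorrelates f A u v d (insert B 𝓣) η) :
    PartialCorrelates f A u v d 𝓣 (η ^ 2 ^ (d + 2)) := by
  obtain ⟨a, b, ha1, had, hb, hη'⟩ := h
  obtain ⟨hBA, hBd, hvB⟩ := h𝓣 B (Finset.mem_insert_self _ _)
  have huB : u ∉ B := fun h => hu (hBA h)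
  have huv : u ≠ v := fun h => huB (h ▸ hvB)
  let g : (ι → G) → ℝ := (∏ C ∈ 𝓣, a C) * b
  -- Every factor except a_B misses a coordinate of B. A factor of `b ∘ shear u v` on C pulls back
  -- to C ∪ {u} or, if v ∉ C, to C; containing B would force C = B, which the condition C ∉ 𝓣 in
  -- `PartialCorrelates` excludes.
  have hg : g ∈ productClass G {C : Finset ι | ∃ j ∈ B, j ∉ C} := by
    refine mul_mem (prod_mem fun C hC => ?_) (productClass_unshear huv hb fun C hC => ?_)
    · refine mem_productClass_of_dependsOn (ha1 C) ?_ (had C)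
      have hne : C ≠ B := fun h => hB𝓣 (h ▸ hC)
      by_contra hcon
      simp only [Set.mem_ofPred_eq, not_exists, not_and, not_not] at hcon
      exact hne (Finset.eq_of_subset_of_card_le hcon
        (by rw [hBd, (h𝓣 C (Finset.mem_insert_of_mem hC)).2.1])).symm
    · obtain ⟨-, hCd, hCT⟩ := hC
      by_cases hvC : v ∈ C
      · refine ⟨insert u C, ?_, Finset.subset_insert _ _, fun _ => Finset.mem_insert_self _ _⟩
        by_contra hcon
        simp only [Set.mem_ofPred_eq, not_exists, not_and, not_not] at hcon
        have hBC : B ⊆ C := fun i hi =>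
          (Finset.mem_insert.1 (hcon i hi)).resolve_left fun h => huB (h ▸ hi)
        have := Finset.eq_of_subset_of_card_le hBC (by rw [hBd]; exact hCd)
        exact hCT (this ▸ Finset.mem_insert_self _ _)
      · exact ⟨C, ⟨v, hvB, hvC⟩, subset_rfl, fun h => absurd h hvC⟩
  let R : (ι → G) → ℝ := fun w => f (∑ i ∈ A, w i) * g w
  have hR1 : ∀ w, |R w| ≤ 1 := fun w => by
    rw [abs_mul]
    exact mul_le_one₀ (hf _) (abs_nonneg _) (abs_le_one_of_mem_productClass hg w)
  let D : (ι → G) → ℝ := fun w => 𝔼 y, R (B.piecewise w y)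
  have hD : DependsOn D (B : Set ι) := dependsOn_expect_piecewise B R
  have hD1 : ∀ w, |D w| ≤ 1 := fun w => abs_expect_le_one fun y => hR1 _
  have h1 : η ^ 2 ≤ 𝔼 w, f (∑ i ∈ A, w i) * D w * g w := by
    have e1 : 𝔼 w : ι → G, f (∑ i ∈ A, w i) * ((∏ B ∈ insert B 𝓣, a B w) * b w) =
        𝔼 w, R w * a B w := by
      refine Finset.expect_congr rfl fun w _ => ?_
      rw [Finset.prod_insert hB𝓣]
      simp only [R, g, Pi.mul_apply, Finset.prod_apply]
      ring
    rw [e1] at hη'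
    refine (pow_le_pow_left₀ hη hη' 2).trans
      ((sq_expect_mul_le_of_dependsOn (had B) (ha1 B) R).trans_eq ?_)
    refine Finset.expect_congr rfl fun w _ => ?_
    change f (∑ i ∈ A, w i) * g w * D w = _
    ring
  have h2 : η ^ 2 ^ (d + 2) ≤
      𝔼 h : ι → G, (𝔼 x, ∏ T ∈ B.powerset, D (T.piecewise (x + h) x)) ^ 2 := by
    have hAB : (A \ B).Nonempty := by
      rw [← Finset.card_pos, Finset.card_sdiff_of_subset hBA]
      omega
    refine le_trans ?_ (pow_abs_expect_le_parallel hBA ⟨v, hvB⟩ hAB hf hD (fun C hC => hC) hg)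
    rw [hBd, show 2 ^ (d + 2) = 2 * 2 ^ (d + 1) by ring, pow_mul]
    exact pow_le_pow_left₀ (by positivity) (h1.trans (le_abs_self _)) _
  obtain ⟨q, hq, hqD⟩ := exists_parallel_le_expect_shear hvB huB hD hD1
  have hq𝓖 : q ∈ productClass G {C | C ⊆ insert u A ∧ C.card ≤ d ∧ C ∉ 𝓣} := by
    refine productClass_mono ?_ hq
    rintro C (rfl | ⟨huC, hC, hCd⟩)
    · exact ⟨hBA.trans (Finset.subset_insert _ _), hBd.le, hB𝓣⟩
    · exact ⟨hC.trans (Finset.insert_subset_insert _ hBA), hBd ▸ hCd,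
        fun hC𝓣 => hu ((h𝓣 C (Finset.mem_insert_of_mem hC𝓣)).1 huC)⟩
  have hqs : (q ∘ unshear u v) ∘ shear u v = q := by
    ext w
    simp [unshear_shear huv]
  have hq' : DependsOn (q ∘ unshear u v) ((insert u B : Finset ι) : Set ι) := by
    have hmem : q ∘ unshear u v ∈ productClass G {insert u B} := by
      refine productClass_unshear huv (hqs ▸ hq) fun C hC => ?_
      refine ⟨insert u B, rfl, ?_, fun _ => Finset.mem_insert_self _ _⟩
      rcases hC with rfl | ⟨-, hC, -⟩
      · exact Finset.subset_insert _ _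
      · exact hC
    obtain ⟨k, -, hk, hk'⟩ := exists_eq_prod_of_mem_productClass hmem {()} (fun _ => insert u B)
      (fun C hC => ⟨(), by simp, by rw [Set.mem_singleton_iff.1 hC]⟩)
    intro x y hxy
    rw [hk', hk']
    exact Finset.prod_congr rfl fun j _ => hk j hxy
  have h3 : η ^ 2 ^ (d + 2) ≤ 𝔼 c : G, 𝔼 w, R (w + Pi.single u c) * (q ∘ unshear u v) w := by
    rw [← expect_dual_mul huB R hq']
    refine (h2.trans hqD).trans_eq ?_
    rw [← expect_shear huv fun w => (𝔼 y, R (B.piecewise w y)) * (q ∘ unshear u v) w]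
    refine Finset.expect_congr rfl fun w _ => ?_
    rw [Function.comp_apply, unshear_shear huv]
  -- The shift in u affects neither f(∑_A) nor the factors indexed by 𝓣, as u ∉ A; only b changes.
  obtain ⟨c, hc⟩ := exists_le_of_le_expect_univ h3
  refine ⟨a, fun w => b (w + Pi.single u c) * (q ∘ unshear u v) w, ha1, had, ?_, hc.trans_eq ?_⟩
  · have e1 : (fun w => b (w + Pi.single u c) * (q ∘ unshear u v) w) ∘ shear u v =
        ((b ∘ shear u v) ∘ fun w => w + Pi.single u c - Pi.single v c) * q := by
      ext w
      simp only [Function.comp_apply, Pi.mul_apply, unshear_shear huv]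
      congr 2
      ext i
      by_cases hiv : i = v
      · subst hiv
        simp [shear_self, huv]
      · simp [shear_of_ne hiv, hiv]
    rw [e1]
    refine mul_mem ?_ hq𝓖
    refine comp_mem_productClass hb _ fun C hC => ?_
    refine ⟨C, ⟨hC.1, hC.2.1, fun h => hC.2.2 (Finset.mem_insert_of_mem h)⟩, fun x y hxy i hi => ?_⟩
    simp [hxy i hi]
  · refine Finset.expect_congr rfl fun w _ => ?_
    have e1 : ∑ i ∈ A, (w + Pi.single u c : ι → G) i = ∑ i ∈ A, w i := by
      refine Finset.sum_congr rfl fun i hi => ?_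
      have : i ≠ u := fun h => hu (h ▸ hi)
      simp [this]
    have e2 : ∀ C ∈ 𝓣, a C (w + Pi.single u c) = a C w := by
      intro C hC
      refine had C fun i hi => ?_
      have : i ≠ u := fun h => hu (h ▸ (h𝓣 C (Finset.mem_insert_of_mem hC)).1 hi)
      simp [this]
    simp only [R, g, e1, Pi.mul_apply, Finset.prod_apply, Finset.prod_congr rfl e2]
    ring

theorem PartialCorrelates.finish {f : G → ℝ} (hf : ∀ s, |f s| ≤ 1) {A : Finset ι} {u v : ι} {d : ℕ}
    (hu : u ∉ A) (hdA : d < A.card) (𝓣 : Finset (Finset ι)) :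
    (∀ C ∈ 𝓣, C ⊆ A ∧ C.card = d ∧ v ∈ C) → ∀ {η : ℝ}, 0 ≤ η →
      PartialCorrelates f A u v d 𝓣 η →
        PartialCorrelates f A u v d ∅ (η ^ 2 ^ ((d + 2) * 𝓣.card)) := by
  induction 𝓣 using Finset.induction_on with
  | empty => intro _ η _ h; simpa using h
  | insert B 𝓣 hB ih =>
    intro h𝓣 η hη h
    have := ih (fun C hC => h𝓣 C (Finset.mem_insert_of_mem hC)) (by positivity)
      (h.step hf hB h𝓣 hu hdA hη)
    rwa [← pow_mul, ← pow_add, show d + 2 + (d + 2) * 𝓣.card = (d + 2) * (insert B 𝓣).card by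
      rw [Finset.card_insert_of_notMem hB]; ring] at this

theorem SumCorrelates.insert_coord {f : G → ℝ} (hf : ∀ s, |f s| ≤ 1) {A : Finset ι} {u : ι} {d : ℕ}
    (hu : u ∉ A) (hdA : d < A.card) {η : ℝ} (hη : 0 ≤ η) (hη1 : η ≤ 1)
    (h : SumCorrelates f A d η) :
    SumCorrelates f (insert u A) d (η ^ 2 ^ ((d + 2) * 2 ^ A.card)) := by
  obtain ⟨g, hg, hgη⟩ := h
  obtain ⟨v, hv⟩ : A.Nonempty := Finset.card_pos.1 (by omega)
  have huv : u ≠ v := fun h => hu (h ▸ hv)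
  obtain ⟨a, ha1, had, hag⟩ := exists_eq_prod_of_mem_productClass hg (A.powersetCard d) id
    (fun B hB => by
      obtain ⟨C, hBC, hCA, hC⟩ := Finset.exists_subsuperset_card_eq hB.1 hB.2 hdA.le
      exact ⟨C, Finset.mem_powersetCard.2 ⟨hCA, hC⟩, hBC⟩)
  have hP : PartialCorrelates f A u v d ((A.powersetCard d).filter (v ∈ ·)) η := by
    -- Factors avoiding v are unchanged by the shear, so they may start out in b.
    refine ⟨a, ∏ C ∈ (A.powersetCard d).filter (v ∉ ·), a C, ha1, had, ?_, hgη.trans_eq ?_⟩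
    · have e1 : (∏ C ∈ (A.powersetCard d).filter (v ∉ ·), a C) ∘ shear u v =
          ∏ C ∈ (A.powersetCard d).filter (v ∉ ·), a C := by
        ext w
        simp only [Function.comp_apply, Finset.prod_apply]
        refine Finset.prod_congr rfl fun C hC => had C fun i hi => shear_of_ne ?_ _
        rintro rfl
        exact (Finset.mem_filter.1 hC).2 hi
      rw [e1]
      refine prod_mem fun C hC => mem_productClass_of_dependsOn (ha1 C) ?_ (had C)
      obtain ⟨hC, hvC⟩ := Finset.mem_filter.1 hC
      obtain ⟨hCA, hCd⟩ := Finset.mem_powersetCard.1 hC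
      exact ⟨hCA.trans (Finset.subset_insert _ _), hCd.le, by simp [hvC]⟩
    · refine Finset.expect_congr rfl fun w _ => ?_
      rw [hag, Finset.prod_apply, Finset.prod_filter_mul_prod_filter_not]
  obtain ⟨a', b, -, -, hb, hbη⟩ := hP.finish hf hu hdA _ (fun C hC => by
    obtain ⟨hC, hvC⟩ := Finset.mem_filter.1 hC
    obtain ⟨hCA, hCd⟩ := Finset.mem_powersetCard.1 hC
    exact ⟨hCA, hCd, hvC⟩) hη
  refine ⟨b ∘ shear u v, productClass_mono (fun C hC => And.intro hC.1 hC.2.1) hb, ?_⟩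
  have hcard : ((A.powersetCard d).filter (v ∈ ·)).card ≤ 2 ^ A.card := by
    rw [← Finset.card_powerset]
    exact Finset.card_le_card ((Finset.filter_subset _ _).trans fun C hC =>
      Finset.mem_powerset.2 (Finset.mem_powersetCard.1 hC).1)
  refine (pow_le_pow_of_le_one hη hη1 (Nat.pow_le_pow_right two_pos
    (Nat.mul_le_mul_left (d + 2) hcard))).trans (hbη.trans_eq ?_)
  simp only [Finset.prod_empty, one_mul]
  rw [← expect_shear huv]
  refine Finset.expect_congr rfl fun w _ => ?_
  rw [sum_shear hu hv, Function.comp_apply]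

/-- After fixing y, the vertex T = ∅ is f(∑ x_i), and every other vertex loses the coordinates in T.
-/
theorem sumCorrelates_gowersAverage {f : G → ℝ} (hf : ∀ s, |f s| ≤ 1) {A : Finset ι} {d : ℕ}
    (hA : A.card = d + 1) : SumCorrelates f A d (gowersAverage (d + 1) f) := by
  have hA0 : A.Nonempty := Finset.card_pos.1 (by omega)
  have h := (expect_prod_powerset_eq_gowersAverage subset_rfl hA0 hA f).symm.le
  rw [Finset.expect_comm] at h
  obtain ⟨y, hy⟩ := exists_le_of_le_expect_univ h
  refine ⟨∏ T ∈ A.powerset.erase ∅, fun x => f (∑ i ∈ A, T.piecewise y x i),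
    prod_mem fun T hT => ?_, hy.trans_eq ?_⟩
  · rw [Finset.mem_erase, Finset.mem_powerset] at hT
    refine mem_productClass_of_dependsOn (fun _ => hf _) (B := A \ T)
      ⟨Finset.sdiff_subset, ?_⟩ fun x x' hx => ?_
    · have h2 := Finset.card_sdiff_add_card_eq_card hT.2
      have h3 := (Finset.nonempty_iff_ne_empty.2 hT.1).card_pos
      omega
    · congr 1
      refine Finset.sum_congr rfl fun i hi => ?_
      by_cases hiT : i ∈ T
      · simp [hiT]
      · simp [hiT, hx i (by simp [hi, hiT])]
  · refine Finset.expect_congr rfl fun x _ => ?_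
    rw [← Finset.mul_prod_erase _ _ (Finset.empty_mem_powerset A)]
    simp [Finset.prod_apply]

theorem gowersAverage_le_one {f : G → ℝ} (hf : ∀ s, |f s| ≤ 1) (n : ℕ) : gowersAverage n f ≤ 1 :=
  Finset.expect_le Finset.univ_nonempty fun _ _ => Finset.expect_le Finset.univ_nonempty fun _ _ =>
    (le_abs_self _).trans (abs_prod_le_one _ fun _ => hf _)

theorem abs_expect_comp_sum_mul_pow_le {f : G → ℝ} {A K : Finset ι} (hKA : K ⊆ A)
    (hK : K.Nonempty) {n : ℕ} (hn : K.card = n) {𝓕 : Set (Finset ι)}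
    (h𝓕 : ∀ B ∈ 𝓕, ∃ j ∈ K, j ∉ B) {g : (ι → G) → ℝ} (hg : g ∈ productClass G 𝓕) :
    |𝔼 x : ι → G, f (∑ i ∈ A, x i) * g x| ^ 2 ^ n ≤ gowersAverage n f := by
  rw [← expect_prod_powerset_eq_gowersAverage hKA (hK.mono hKA) hn f, ← hn]
  exact abs_expect_mul_pow_le hK _ h𝓕 hg

theorem gowersAverage_nonneg (f : G → ℝ) {n : ℕ} (hn : n ≠ 0) : 0 ≤ gowersAverage n f := by
  have : NeZero n := ⟨hn⟩
  exact le_trans (by positivity) (abs_expect_comp_sum_mul_pow_le (ι := Fin n) (f := f)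
    (Finset.Subset.refl Finset.univ) Finset.univ_nonempty (Finset.card_fin n)
    (𝓕 := ∅) (by simp) (one_mem _))

theorem sumCorrelates_of_lt_card {f : G → ℝ} (hf : ∀ s, |f s| ≤ 1) {d n : ℕ} (hn : d + 1 ≤ n) :
    ∀ A : Finset ι, A.card = n →
      SumCorrelates f A d (gowersAverage (d + 1) f ^ 2 ^ ((d + 2) * 2 ^ n)) := by
  have h0 := gowersAverage_nonneg f (Nat.succ_ne_zero d)
  have h1 := gowersAverage_le_one hf (d + 1)
  induction n, hn using Nat.le_induction with
  | base =>
    intro A hA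
    obtain ⟨g, hg, h⟩ := sumCorrelates_gowersAverage hf hA
    -- The base case holds with exponent 1. The weaker bound is chosen so that each new coordinate
    -- exactly doubles (d + 2) 2^n.
    exact ⟨g, hg, (pow_le_of_le_one h0 h1 (by positivity)).trans h⟩
  | succ n hn ih =>
    intro A hA
    obtain ⟨u, A', hu, rfl, hA'⟩ := Finset.card_eq_succ.1 hA
    have := (ih A' hA').insert_coord hf hu (by omega) (pow_nonneg h0 _) (pow_le_one₀ h0 h1)
    rwa [hA', ← pow_mul, ← pow_add,
      show (d + 2) * 2 ^ n + (d + 2) * 2 ^ n = (d + 2) * 2 ^ (n + 1) by ring] at this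

end Correlation

/-! ### From bounded functions to sets. -/

theorem setInd_of_mem {α : Type*} {S : Set α} {x : α} (h : x ∈ S) : setInd S x = 1 :=
  Set.indicator_of_mem h _

theorem setInd_of_notMem {α : Type*} {S : Set α} {x : α} (h : x ∉ S) : setInd S x = 0 :=
  Set.indicator_of_notMem h _

theorem abs_setInd_le_one {α : Type*} (S : Set α) (x : α) : |setInd S x| ≤ 1 := by
  by_cases h : x ∈ S
  · simp [setInd_of_mem h]
  · simp [setInd_of_notMem h]

section Sets

variable {ι V : Type*} [Fintype ι] [DecidableEq ι] [Fintype V] [Nonempty V]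

/-- The best bounded test function is the sign of the conditional average D, which is 1_P - 1_{Pᶜ}
with P = {D ≥ 0}; one of the two sets carries at least half. -/
theorem exists_set_abs_expect_mul_le (F : (ι → V) → ℝ) {B : Finset ι} {g : (ι → V) → ℝ}
    (hg : DependsOn g (B : Set ι)) (hg1 : ∀ x, |g x| ≤ 1) :
    ∃ S : Set (B → V), |𝔼 x, F x * g x| ≤ 2 * |𝔼 x, F x * setInd S (fun j => x j.1)| := by
  let D : (ι → V) → ℝ := fun x => 𝔼 y, F (B.piecewise x y)
  have hD : DependsOn D (B : Set ι) := dependsOn_expect_piecewise B F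
  let e : (B → V) → ι → V := fun y i => if h : i ∈ B then y ⟨i, h⟩ else Classical.arbitrary V
  have he : ∀ x, D (e fun j => x j.1) = D x := fun x => hD fun i hi => by
    have hi' : i ∈ B := hi
    simp [e, hi']
  let P : Set (B → V) := {y | 0 ≤ D (e y)}
  have hset : ∀ S : Set (B → V), 𝔼 x, F x * setInd S (fun j => x j.1) =
      𝔼 x, D x * setInd S (fun j => x j.1) := fun S =>
    expect_mul_of_dependsOn (fun x y hxy => by
      congr 1
      ext j
      exact hxy j.1 j.2) F
  have key : |𝔼 x, F x * g x| ≤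
      𝔼 x, F x * setInd P (fun j => x j.1) - 𝔼 x, F x * setInd Pᶜ (fun j => x j.1) := by
    rw [expect_mul_of_dependsOn hg, hset, hset, ← Finset.expect_sub_distrib]
    refine (Finset.abs_expect_le _ _).trans (Finset.expect_le_expect fun x _ => ?_)
    change |D x * g x| ≤ _
    rw [abs_mul]
    refine (mul_le_of_le_one_right (abs_nonneg _) (hg1 x)).trans ?_
    by_cases hx : 0 ≤ D x
    · have h1 : (fun j : B => x j.1) ∈ P := by change 0 ≤ D _; rwa [he]
      rw [setInd_of_mem h1, setInd_of_notMem (S := Pᶜ) (fun h => h h1), abs_of_nonneg hx]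
      simp
    · have h1 : (fun j : B => x j.1) ∉ P := by change ¬ 0 ≤ D _; rwa [he]
      rw [setInd_of_mem (S := Pᶜ) h1, setInd_of_notMem h1, abs_of_neg (not_le.1 hx)]
      simp
  by_contra! hcon
  have h1 := hcon P
  have h2 := hcon Pᶜ
  have h3 := le_abs_self (𝔼 x, F x * setInd P (fun j => x j.1))
  have h4 := neg_abs_le (𝔼 x, F x * setInd Pᶜ (fun j => x j.1))
  linarith

theorem exists_sets_abs_expect_mul_prod_le {κ : Type*} [DecidableEq κ] (c : κ → Finset ι)
    (g : κ → (ι → V) → ℝ) (hg : ∀ B, DependsOn (g B) (c B : Set ι)) (hg1 : ∀ B x, |g B x| ≤ 1)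
    (s : Finset κ) :
    ∀ F : (ι → V) → ℝ, ∃ S : (B : κ) → Set (c B → V), |𝔼 x, F x * ∏ B ∈ s, g B x| ≤
      2 ^ s.card * |𝔼 x, F x * ∏ B ∈ s, setInd (S B) (fun j => x j.1)| := by
  induction s using Finset.induction_on with
  | empty => intro F; exact ⟨fun _ => ∅, by simp⟩
  | insert C s hC ih =>
    intro F
    obtain ⟨S, hS⟩ := ih fun x => F x * g C x
    obtain ⟨S', hS'⟩ := exists_set_abs_expect_mul_le
      (fun x => F x * ∏ B ∈ s, setInd (S B) (fun j => x j.1)) (hg C) (hg1 C)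
    refine ⟨Function.update S C S', ?_⟩
    have e1 : ∀ x : ι → V, F x * ∏ B ∈ insert C s, setInd (Function.update S C S' B)
        (fun j => x j.1) = (F x * ∏ B ∈ s, setInd (S B) (fun j => x j.1)) *
          setInd S' (fun j => x j.1) := by
      intro x
      have e : ∀ B ∈ s, setInd (Function.update S C S' B) (fun j => x j.1) =
          setInd (S B) (fun j => x j.1) := fun B hB => by
        rw [Function.update_of_ne (ne_of_mem_of_not_mem hB hC)]
      rw [Finset.prod_insert hC, Function.update_self, Finset.prod_congr rfl e]
      ring
    have e2 : ∀ x : ι → V, F x * ∏ B ∈ insert C s, g B x = F x * g C x * ∏ B ∈ s, g B x := by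
      intro x
      rw [Finset.prod_insert hC]; ring
    have e3 : ∀ x : ι → V, F x * g C x * ∏ B ∈ s, setInd (S B) (fun j => x j.1) =
        (F x * ∏ B ∈ s, setInd (S B) (fun j => x j.1)) * g C x := fun x => by ring
    simp only [e1, e2]
    simp only [e3] at hS
    rw [Finset.card_insert_of_notMem hC, pow_succ, mul_assoc]
    exact hS.trans (mul_le_mul_of_nonneg_left hS' (by positivity))

theorem abs_expect_le_cutNorm {V : Type*} [Fintype V] {k d : ℕ} (f : (Fin k → V) → ℝ)
    (S : (B : {B : Finset (Fin k) // B.card = d}) → Set (B.1 → V)) :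
    |𝔼 x : Fin k → V, f x * ∏ B, setInd (S B) (fun j => x j.1)| ≤ cutNorm d f :=
  le_ciSup (f := fun S : (B : {B : Finset (Fin k) // B.card = d}) → Set (B.1 → V) =>
    |𝔼 x : Fin k → V, f x * ∏ B, setInd (S B) (fun j => x j.1)|) (Set.finite_range _).bddAbove S

theorem setDensity_eq_expect {V : Type*} [Fintype V] (A : Set V) :
    setDensity A = 𝔼 x, setInd A x := by
  classical
  rw [setDensity, Fintype.expect_eq_sum_div_card]
  congr 1
  simp only [setInd, Set.indicator_apply, Finset.sum_boole]
  rw [Set.ncard_eq_toFinset_card']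
  congr 2
  ext
  simp

end Sets

/-! ### Cayley hypergraphs and the two implications. -/

section Cayley

variable {G : Type*} [AddCommGroup G] [Fintype G]

theorem setInd_cayleyKGraph {G : Type*} [AddCommGroup G] {k : ℕ} (A : Set G) (x : Fin k → G) :
    setInd (cayleyKGraph k A).edges x = setInd A (∑ i, x i) := by
  by_cases h : ∑ i, x i ∈ A
  · rw [setInd_of_mem h, setInd_of_mem (show x ∈ (cayleyKGraph k A).edges from h)]
  · rw [setInd_of_notMem h, setInd_of_notMem (show x ∉ (cayleyKGraph k A).edges from h)]

theorem density_cayleyKGraph {k : ℕ} (hk : k ≠ 0) (A : Set G) :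
    (cayleyKGraph k A).density = setDensity A := by
  have : NeZero k := ⟨hk⟩
  have h1 : (cayleyKGraph k A).density = setDensity (cayleyKGraph k A).edges := by
    simp [KGraph.density, setDensity]
  rw [h1, setDensity_eq_expect, setDensity_eq_expect,
    ← expect_sum_eq (ι := Fin k) Finset.univ_nonempty (setInd A) 0]
  simp only [setInd_cayleyKGraph, add_zero]

theorem disc_cayleyKGraph {k : ℕ} (hk : k ≠ 0) (d : ℕ) (A : Set G) :
    (cayleyKGraph k A).disc d =
      cutNorm d fun x : Fin k → G => setInd A (∑ i, x i) - setDensity A := by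
  simp only [KGraph.disc, density_cayleyKGraph hk, setInd_cayleyKGraph]

theorem abs_setInd_sub_setDensity_le_one (A : Set G) (x : G) : |setInd A x - setDensity A| ≤ 1 := by
  have h0 : ∀ y, 0 ≤ setInd A y := fun y => Set.indicator_nonneg (fun _ _ => zero_le_one) y
  have h1 : ∀ y, setInd A y ≤ 1 := fun y => (le_abs_self _).trans (abs_setInd_le_one A y)
  have h2 : 0 ≤ setDensity A := by
    rw [setDensity_eq_expect]; exact Finset.expect_nonneg fun y _ => h0 y
  have h3 : setDensity A ≤ 1 := by
    rw [setDensity_eq_expect]; exact Finset.expect_le Finset.univ_nonempty fun y _ => h1 y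
  rw [abs_le]
  constructor <;> linarith [h0 x, h1 x]

theorem uniformityNorm_eq_rpow (n : ℕ) (f : G → ℝ) :
    uniformityNorm n f = gowersAverage n f ^ ((1 : ℝ) / 2 ^ n) := rfl

theorem uniformityNorm_nonneg (f : G → ℝ) {n : ℕ} (hn : n ≠ 0) : 0 ≤ uniformityNorm n f :=
  Real.rpow_nonneg (gowersAverage_nonneg f hn) _

theorem uniformityNorm_pow (f : G → ℝ) {n : ℕ} (hn : n ≠ 0) :
    uniformityNorm n f ^ 2 ^ n = gowersAverage n f := by
  rw [uniformityNorm_eq_rpow, one_div]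
  have := Real.rpow_inv_natCast_pow (gowersAverage_nonneg f hn) (n := 2 ^ n) (by positivity)
  push_cast at this
  exact this

theorem cutNorm_comp_sum_le_uniformityNorm {d k : ℕ} (hk : d + 1 ≤ k) (f : G → ℝ) :
    cutNorm d (fun x : Fin k → G => f (∑ i, x i)) ≤ uniformityNorm (d + 1) f := by
  have : Nonempty ((B : {B : Finset (Fin k) // B.card = d}) → Set (B.1 → G)) := ⟨fun _ => ∅⟩
  refine ciSup_le fun S => ?_
  obtain ⟨K, hK⟩ : ∃ K : Finset (Fin k), K.card = d + 1 := by
    obtain ⟨K, -, hK⟩ := Finset.exists_subset_card_eq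
      (s := (Finset.univ : Finset (Fin k))) (n := d + 1) (by simpa using hk)
    exact ⟨K, hK⟩
  refine le_of_pow_le_pow_left₀ (n := 2 ^ (d + 1)) (by positivity)
    (uniformityNorm_nonneg f (Nat.succ_ne_zero d)) ?_
  rw [uniformityNorm_pow f (Nat.succ_ne_zero d)]
  have hmem : (∏ B : {B : Finset (Fin k) // B.card = d},
      fun x : Fin k → G => setInd (S B) (fun j => x j.1)) ∈
        productClass G {B : Finset (Fin k) | B.card = d} := by
    refine prod_mem fun B _ => mem_productClass_of_dependsOn (fun x => abs_setInd_le_one _ _)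
      (B := B.1) B.2 fun x y hxy => ?_
    congr 1
    ext j
    exact hxy j.1 j.2
  have h := abs_expect_comp_sum_mul_pow_le (f := f) (Finset.subset_univ K)
    (Finset.card_pos.1 (by omega)) hK (fun B hB => by
      by_contra! hcon
      have h1 := Finset.card_le_card (s := K) (t := B) hcon
      have h2 : B.card = d := hB
      omega) hmem
  simpa only [Finset.prod_apply] using h

theorem gowersAverage_pow_le_cutNorm {d k : ℕ} (hk : d + 1 ≤ k) {f : G → ℝ}
    (hf : ∀ s, |f s| ≤ 1) :
    gowersAverage (d + 1) f ^ 2 ^ ((d + 2) * 2 ^ k) ≤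
      2 ^ 2 ^ k * cutNorm d (fun x : Fin k → G => f (∑ i, x i)) := by
  obtain ⟨g, hg, h⟩ := sumCorrelates_of_lt_card hf hk (Finset.univ : Finset (Fin k)) (by simp)
  obtain ⟨a, ha1, had, hag⟩ := exists_eq_prod_of_mem_productClass hg
    (Finset.univ : Finset {B : Finset (Fin k) // B.card = d}) Subtype.val (fun B hB => by
      obtain ⟨C, hBC, -, hC⟩ := Finset.exists_subsuperset_card_eq (n := d) hB.1 hB.2
        (by simp; omega)
      exact ⟨⟨C, hC⟩, Finset.mem_univ _, hBC⟩)
  obtain ⟨S, hS⟩ := exists_sets_abs_expect_mul_prod_le Subtype.val a had ha1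
    (Finset.univ : Finset {B : Finset (Fin k) // B.card = d}) fun x => f (∑ i, x i)
  simp only [hag] at h
  refine h.trans ((le_abs_self _).trans (hS.trans ?_))
  have h1 := abs_expect_le_cutNorm (fun x : Fin k → G => f (∑ i, x i)) S
  -- One factor 2 per d-set, and there are at most 2^k of these.
  refine mul_le_mul (pow_le_pow_right₀ one_le_two ?_) h1 (abs_nonneg _) (by positivity)
  rw [Finset.card_univ]
  exact (Fintype.card_subtype_le _).trans (by simp)

theorem uniformityNorm_le_of_cutNorm_le {d k : ℕ} (hd : 1 ≤ d) (hk : d + 1 ≤ k) {f : G → ℝ}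
    (hf : ∀ s, |f s| ≤ 1) {ε : ℝ} (hε : 0 ≤ ε)
    (h : cutNorm d (fun x : Fin k → G => f (∑ i, x i)) ≤ ε) :
    uniformityNorm (d + 1) f ≤
      2 * ε ^ ((2 : ℝ) ^ (-(((d : ℝ) + 2) * (2 * (d : ℝ) + 2) ^ k))) := by
  set m : ℕ := (d + 2) * (2 * d + 2) ^ k with hm
  have hc : (2 : ℝ) ^ (-(((d : ℝ) + 2) * (2 * (d : ℝ) + 2) ^ k)) = (((2 ^ m : ℕ) : ℝ))⁻¹ := by
    rw [Real.rpow_neg zero_le_two,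
      show ((d : ℝ) + 2) * (2 * (d : ℝ) + 2) ^ k = (m : ℕ) by rw [hm]; push_cast; ring,
      Real.rpow_natCast]
    push_cast
    rfl
  have h0 := uniformityNorm_nonneg f (Nat.succ_ne_zero d)
  have h1 : uniformityNorm (d + 1) f ≤ 1 :=
    Real.rpow_le_one (gowersAverage_nonneg f (Nat.succ_ne_zero d)) (gowersAverage_le_one hf _)
      (by positivity)
  -- Here d ≥ 1 gives 2d + 2 ≥ 4. The extra 1 absorbs the d + 1 squarings relating the norm to its
  -- Gowers average.
  have h2 : 2 ^ k + 1 ≤ (2 * d + 2) ^ k := by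
    have e1 : 4 ^ k ≤ (2 * d + 2) ^ k := Nat.pow_le_pow_left (by omega) k
    have e2 : (4 : ℕ) ^ k = 2 ^ k * 2 ^ k := by rw [← mul_pow]; norm_num
    have e3 : 2 ≤ 2 ^ k := by
      simpa using Nat.pow_le_pow_right (n := 2) two_pos (show 1 ≤ k by omega)
    nlinarith
  have h3 : d + 1 + (d + 2) * 2 ^ k ≤ m := by
    have := Nat.mul_le_mul_left (d + 2) h2
    rw [hm]
    linarith
  -- This lets 2^(2^k) be raised to 2^(2^m), whose 2^m-th root is the constant 2.
  have h4 : k ≤ m := by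
    have := Nat.lt_two_pow_self (n := k)
    nlinarith
  rw [hc]
  refine le_of_pow_le_pow_left₀ (n := 2 ^ m) (by positivity) (by positivity) ?_
  rw [mul_pow, Real.rpow_inv_natCast_pow hε (by positivity)]
  calc uniformityNorm (d + 1) f ^ 2 ^ m
      ≤ uniformityNorm (d + 1) f ^ 2 ^ (d + 1 + (d + 2) * 2 ^ k) :=
        pow_le_pow_of_le_one h0 h1 (Nat.pow_le_pow_right two_pos h3)
    _ = gowersAverage (d + 1) f ^ 2 ^ ((d + 2) * 2 ^ k) := by
        rw [pow_add 2, pow_mul, uniformityNorm_pow f (Nat.succ_ne_zero d)]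
    _ ≤ 2 ^ 2 ^ k * ε :=
        (gowersAverage_pow_le_cutNorm hk hf).trans (mul_le_mul_of_nonneg_left h (by positivity))
    _ ≤ 2 ^ 2 ^ m * ε := mul_le_mul_of_nonneg_right
        (pow_le_pow_right₀ one_le_two (Nat.pow_le_pow_right two_pos h4)) hε

end Cayley

theorem theorem1p1 {G : Type*} [AddCommGroup G] [Fintype G] (A : Set G)
    (d : ℕ) (hd : 1 ≤ d) (ε : ℝ) (hε : ε ∈ Set.Ioo (0 : ℝ) 1) :
    (IsUniformOfDegree ε d A →
      ∀ k : ℕ, d + 1 ≤ k → (cayleyKGraph k A).IsQuasirandomOfOrder ε d) ∧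
    (∀ k : ℕ, d + 1 ≤ k → (cayleyKGraph k A).IsQuasirandomOfOrder ε d →
      IsUniformOfDegree
        (2 * ε ^ ((2 : ℝ) ^ (-(((d : ℝ) + 2) * (2 * (d : ℝ) + 2) ^ k)))) d A) := by
  refine ⟨fun h k hk => ?_, fun k hk h => ?_⟩
  · rw [KGraph.IsQuasirandomOfOrder, disc_cayleyKGraph (by omega)]
    exact (cutNorm_comp_sum_le_uniformityNorm hk fun x => setInd A x - setDensity A).trans h
  · rw [KGraph.IsQuasirandomOfOrder, disc_cayleyKGraph (by omega)] at h
    exact uniformityNorm_le_of_cutNorm_le hd hk (abs_setInd_sub_setDensity_le_one A) hε.1.le h
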